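/- A (finite) word is square-free if it cannot be written as $UXXV$ with $X$ a nonempty word. A square-free word $W$ over an alphabet $\mathbb{A}$ is extendable at the position given by a factorization $W=W'W''$ if $W'xW''$ is square-free for some letter $x\in\mathbb{A}$; the position is inner if both $W'$ and $W''$ are nonempty. For every integer $t\geqslant 87$ there exists a square-free word $W$ over a $5$-letter alphabet, of length at least $t+1$ (so that it has at least $t$ inner positions), which is non-extendable at any of its $t$ rightmost inner positions; that is, for every factorization $W=W'W''$ with $1\leqslant |W''|\leqslant t$ and every letter $x$ of the $5$-letter alphabet, the word $W'xW''$ contains a square. -/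

import Mathlib

namespace SquareFreeWords

/-- A word (a list of letters) is square-free if it cannot be written as `U X X V`
with `X` nonempty. -/
def SquareFree {α : Type*} (W : List α) : Prop :=
  ∀ U X V : List α, W = U ++ X ++ X ++ V → X = []

/-- The positions of a word `W`, i.e. the places where a letter can be inserted, correspond to
the factorizations `W = W' W''`, and we index them from the right by `k = |W''|`.
`W` is extendable at position `k` if some letter `x` of the alphabet can be inserted there so
that the extension `W' x W''` is square-free. The position is inner (both `W'` and `W''` are
nonempty) exactly when `1 ≤ k < |W|`. -/
def ExtendableAt {α : Type*} (W : List α) (k : ℕ) : Prop :=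
  ∃ (W' W'' : List α) (x : α), W = W' ++ W'' ∧ W''.length = k ∧ SquareFree (W' ++ x :: W'')

end SquareFreeWords

namespace SquareFreeWords

/-! Let `G` be a long square-free word over three letters, and let `h`, `s` be the other two
letters. The word `W` ends in `s G h`, and all insertions under consideration fall into the last
block `G h`. Such an insertion turns the block into `p x r h` with `G = p r`, or, if `x = s`, into
the two blocks `p` and `r h`. Those results that are not ruled out by a square inside the block form
a finite set of items.

Before `G h` stands the Zimin word on these items, preceded by a further item `L`. For every item
`M` on the list the Zimin word ends in `Z M Z`. An insertion producing `M` therefore makes `W` end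
in `s Z M s Z M`, which is a square (`not_squareFree_joinSep_zimin`).

That `W` itself is square-free follows by induction along the Zimin construction
(`squareFree_joinSep_zimin`): `L Z M Z R` is glued from `L Z M` and `M Z R`. By
`SquareFree.append_sep_append_sep`, a new square must repeat `M` elsewhere or split it as `v u` with
`v` and `u` recurring at block ends. Distinct items share no block, and a long enough prefix or
suffix of an insertion identifies it, so neither can happen (`IsItem.squareFree_joinSep_insert`). -/

/-! ### A square-free ternary word from the Thue–Morse sequence. -/

/-- The Thue–Morse sequence: the parity of the sum of the binary digits. -/
def thueMorse (n : ℕ) : Bool :=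
  if n = 0 then false else xor (n % 2 == 1) (thueMorse (n / 2))
decreasing_by omega

theorem thueMorse_two_mul (n : ℕ) : thueMorse (2 * n) = thueMorse n := by
  rcases Nat.eq_zero_or_pos n with rfl | hn
  · rfl
  · rw [thueMorse, if_neg (by omega)]
    simp

theorem thueMorse_two_mul_add_one (n : ℕ) : thueMorse (2 * n + 1) = !thueMorse n := by
  rw [thueMorse, if_neg (by omega), show (2 * n + 1) / 2 = n by omega,
    show (2 * n + 1) % 2 = 1 by omega]
  simp

theorem thueMorse_not_cube (i : ℕ) :
    ¬ (thueMorse i = thueMorse (i + 1) ∧ thueMorse (i + 1) = thueMorse (i + 2)) := by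
  rintro ⟨h1, h2⟩
  obtain ⟨a, rfl | rfl⟩ := Nat.even_or_odd' i
  · rw [thueMorse_two_mul, thueMorse_two_mul_add_one] at h1
    simp at h1
  · rw [show 2 * a + 1 + 1 = 2 * (a + 1) by ring, show 2 * a + 1 + 2 = 2 * (a + 1) + 1 by ring,
      thueMorse_two_mul, thueMorse_two_mul_add_one] at h2
    simp at h2

theorem thueMorse_succ_eq_of_ne {a : ℕ} (h : thueMorse (2 * a + 1) ≠ thueMorse (2 * a + 2)) :
    thueMorse a = thueMorse (a + 1) := by
  rw [show 2 * a + 2 = 2 * (a + 1) by ring, thueMorse_two_mul, thueMorse_two_mul_add_one] at h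
  simpa using h

theorem thueMorse_two_mul_ne (a : ℕ) : thueMorse (2 * a) ≠ thueMorse (2 * a + 1) := by
  rw [thueMorse_two_mul, thueMorse_two_mul_add_one]
  simp

/-- An even period is halved by keeping only the positions of the parity of `i`. An odd period above
1 moves the unequal pairs at `2b, 2b + 1` onto pairs starting at an odd position, or conversely; two
neighbouring such pairs force three equal consecutive terms. -/
theorem thueMorse_overlapFree (p : ℕ) (hp : 0 < p) (i : ℕ) :
    ¬ ∀ j, i ≤ j → j ≤ i + p → thueMorse j = thueMorse (j + p) := by
  induction p using Nat.strong_induction_on generalizing i with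
  | _ p ih =>
    intro h
    obtain ⟨q, rfl | rfl⟩ := Nat.even_or_odd' p
    · obtain ⟨a, rfl | rfl⟩ := Nat.even_or_odd' i
      · refine ih q (by omega) (by omega) a fun j hj hj' => ?_
        have := h (2 * j) (by omega) (by omega)
        rwa [← mul_add, thueMorse_two_mul, thueMorse_two_mul] at this
      · refine ih q (by omega) (by omega) a fun j hj hj' => ?_
        have := h (2 * j + 1) (by omega) (by omega)
        rw [show 2 * j + 1 + 2 * q = 2 * (j + q) + 1 by ring, thueMorse_two_mul_add_one,
          thueMorse_two_mul_add_one] at this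
        simpa using this
    · rcases Nat.eq_zero_or_pos q with rfl | hq
      · exact thueMorse_not_cube i ⟨h i le_rfl (by omega), h (i + 1) (by omega) (by omega)⟩
      · obtain ⟨a, rfl | rfl⟩ := Nat.even_or_odd' i
        · have key : ∀ b, a ≤ b → b ≤ a + 1 → thueMorse (b + q) = thueMorse (b + q + 1) := by
            intro b hb hb'
            apply thueMorse_succ_eq_of_ne
            have h1 := h (2 * b) (by omega) (by omega)
            have h2 := h (2 * b + 1) (by omega) (by omega)
            rw [show 2 * (b + q) + 1 = 2 * b + (2 * q + 1) by ring, ← h1,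
              show 2 * (b + q) + 2 = 2 * b + 1 + (2 * q + 1) by ring, ← h2]
            exact thueMorse_two_mul_ne b
          refine thueMorse_not_cube (a + q) ⟨key a le_rfl (by omega), ?_⟩
          convert key (a + 1) (by omega) le_rfl using 2 <;> ring
        · have key : ∀ b, a ≤ b → b ≤ a + 1 → thueMorse b = thueMorse (b + 1) := by
            intro b hb hb'
            apply thueMorse_succ_eq_of_ne
            rw [h (2 * b + 1) (by omega) (by omega), h (2 * b + 2) (by omega) (by omega),
              show 2 * b + 1 + (2 * q + 1) = 2 * (b + q + 1) by ring,
              show 2 * b + 2 + (2 * q + 1) = 2 * (b + q + 1) + 1 by ring]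
            exact thueMorse_two_mul_ne _
          exact thueMorse_not_cube a ⟨key a le_rfl (by omega), key (a + 1) (by omega) le_rfl⟩

/-- The differences of consecutive terms of the Thue–Morse sequence, increased by one. -/
def ternaryThueMorse (n : ℕ) : ℕ :=
  1 + (thueMorse (n + 1)).toNat - (thueMorse n).toNat

theorem ternaryThueMorse_lt (n : ℕ) : ternaryThueMorse n < 3 := by
  have := (thueMorse (n + 1)).toNat_le
  unfold ternaryThueMorse
  omega

theorem ternaryThueMorse_not_square (p : ℕ) (hp : 0 < p) (i : ℕ) :
    ¬ ∀ j, i ≤ j → j < i + p → ternaryThueMorse j = ternaryThueMorse (j + p) := by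
  intro h
  -- The equal differences telescope. At `k = p` the bit at `i + p` is the mean of those at `i` and
  -- `i + 2p`, so all three agree and the square lifts to an overlap.
  have hsum : ∀ k ≤ p, (thueMorse (i + k)).toNat + (thueMorse (i + p)).toNat =
      (thueMorse (i + k + p)).toNat + (thueMorse i).toNat := by
    intro k hk
    induction k with
    | zero => simp [add_comm]
    | succ k ihk =>
      have h1 := ihk (by omega)
      have h2 := h (i + k) (by omega) (by omega)
      unfold ternaryThueMorse at h2
      rw [show i + k + p + 1 = i + (k + 1) + p by ring, add_assoc i k 1] at h2
      have := (thueMorse (i + k)).toNat_le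
      have := (thueMorse (i + k + p)).toNat_le
      omega
  have hinj : ∀ {a b : Bool}, a.toNat = b.toNat → a = b := by decide
  have hip : (thueMorse (i + p)).toNat = (thueMorse i).toNat := by
    have := hsum p le_rfl
    have := (thueMorse (i + p)).toNat_le
    have := (thueMorse (i + p + p)).toNat_le
    have := (thueMorse i).toNat_le
    omega
  refine thueMorse_overlapFree p hp i fun j hj hj' => hinj ?_
  have := hsum (j - i) (by omega)
  rw [show i + (j - i) = j by omega] at this
  omega

theorem exists_squareFree_ternary (n : ℕ) :
    ∃ G : List (Fin 5), G.length = n ∧ SquareFree G ∧ ∀ x ∈ G, x.val < 3 := by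
  refine ⟨List.ofFn fun i : Fin n => ⟨ternaryThueMorse i, (ternaryThueMorse_lt i).trans (by omega)⟩,
    by simp, ?_, ?_⟩
  · intro U X V h
    by_contra hX
    have hget : ∀ j (hj : j < n), (U ++ X ++ X ++ V)[j]? =
        some ⟨ternaryThueMorse j, (ternaryThueMorse_lt j).trans (by omega)⟩ := by
      intro j hj
      rw [← h]
      simp [hj]
    have hlen := congrArg List.length h
    simp only [List.length_ofFn, List.length_append] at hlen
    refine ternaryThueMorse_not_square X.length (List.length_pos_iff.2 hX) U.length
      fun j hj hj' => ?_
    have h1 := hget j (by omega)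
    have h2 := hget (j + X.length) (by omega)
    have h3 : (U ++ X ++ X ++ V)[j]? = (U ++ X ++ X ++ V)[j + X.length]? := by
      grind
    rw [h1, h2] at h3
    simpa using h3
  · intro x hx
    obtain ⟨i, rfl⟩ := (List.mem_ofFn' _ _).1 hx
    exact ternaryThueMorse_lt i

/-! ### Squares in words cut by a separator. -/

variable {α : Type*}

theorem SquareFree.of_factor {W T : List α} (hW : SquareFree W) (h : T <:+: W) : SquareFree T := by
  obtain ⟨A, B, rfl⟩ := h
  intro U X V hT
  exact hW (A ++ U) X (V ++ B) (by simp [hT])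

theorem prefix_of_append_eq {s : α} {v q B r : List α} (hv : s ∉ v)
    (h : v ++ q = B ++ s :: r) : v <+: B := by
  rcases List.append_eq_append_iff.1 h with ⟨a, rfl, -⟩ | ⟨c, rfl, hc⟩
  · exact List.prefix_append _ _
  · cases c with
    | nil => simp
    | cons y c => simp_all

theorem eq_of_append_cons_eq {s : α} {M B q r : List α} (hM : s ∉ M) (hB : s ∉ B)
    (h : M ++ s :: q = B ++ s :: r) : M = B ∧ q = r := by
  rcases List.append_eq_append_iff.1 h with ⟨a, rfl, ha⟩ | ⟨a, rfl, ha⟩ <;>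
  cases a <;> simp_all

/-- The letter `s` occurs only once, so it cannot lie in a repeated factor; the square is on one
side of it. -/
theorem SquareFree.append_sep {s : α} {A B : List α} (hA : SquareFree A) (hB : SquareFree B)
    (hsA : s ∉ A) (hsB : s ∉ B) : SquareFree (A ++ s :: B) := by
  intro U X V h
  have hsX : s ∉ X := by
    intro hs
    classical
    have := congrArg (List.count s) h
    simp only [List.count_append, List.count_cons_self, List.count_eq_zero.2 hsA,
      List.count_eq_zero.2 hsB] at this
    have := List.count_pos_iff.2 hs
    omega
  rw [List.append_assoc, List.append_assoc] at h
  rcases List.append_eq_append_iff.1 h with ⟨a, rfl, ha⟩ | ⟨a, rfl, ha⟩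
  · cases a with
    | nil =>
      cases X with
      | nil => rfl
      | cons y X => simp_all
    | cons y a =>
      simp only [List.cons_append, List.cons.injEq] at ha
      exact hB a X V (by simp [ha.2])
  · have h1 : (X ++ X) ++ V = a ++ s :: B := by simp [ha]
    obtain ⟨r, hr⟩ := prefix_of_append_eq (by simp [hsX]) h1
    exact hA U X r (by simp [← hr])

/-- A square in `A s M s C` that lies neither in `A s M` nor in `M s C` either contains `s M s`
in one of its halves, or has its centre inside `M`. -/
theorem SquareFree.append_sep_append_sep {s : α} {A M C : List α}
    (hAM : SquareFree (A ++ s :: M)) (hMC : SquareFree (M ++ s :: C))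
    (hA : ¬ s :: (M ++ [s]) <:+: A) (hC : ¬ s :: (M ++ [s]) <:+: C)
    (hM : ∀ v u, M = v ++ u → u ++ [s] <:+: A ++ s :: M → s :: v <:+: M ++ s :: C → False) :
    SquareFree (A ++ s :: (M ++ s :: C)) := by
  intro U X V h
  have h1 : A ++ s :: M <+: A ++ s :: (M ++ s :: C) := ⟨s :: C, by simp⟩
  have h2 : A ++ [s] <+: A ++ s :: (M ++ s :: C) := ⟨M ++ s :: C, by simp⟩
  have h3 : A ++ s :: (M ++ [s]) <+: A ++ s :: (M ++ s :: C) := ⟨C, by simp⟩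
  have h4 : U ++ X ++ X <+: A ++ s :: (M ++ s :: C) := ⟨V, by rw [h]⟩
  have h5 : U <+: A ++ s :: (M ++ s :: C) := ⟨X ++ X ++ V, by rw [h]; simp⟩
  rcases le_total (U ++ X ++ X).length (A ++ s :: M).length with hl | hl
  · obtain ⟨r, hr⟩ := List.prefix_of_prefix_length_le h4 h1 hl
    exact hAM U X r hr.symm
  rcases le_total (A ++ [s]).length U.length with hl' | hl'
  · obtain ⟨r, rfl⟩ := List.prefix_of_prefix_length_le h2 h5 hl'
    exact hMC r X V (by simpa using h)
  by_cases hle : (U ++ X ++ X).length = (A ++ s :: M).length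
  · obtain ⟨r, hr⟩ := List.prefix_of_prefix_length_le h4 h1 hle.le
    exact hAM U X r hr.symm
  by_cases hle' : (A ++ [s]).length = U.length
  · obtain ⟨r, rfl⟩ := List.prefix_of_prefix_length_le h2 h5 hle'.le
    exact hMC r X V (by simpa using h)
  exfalso
  obtain ⟨a, rfl⟩ := List.prefix_of_prefix_length_le h5 (List.prefix_append A _)
    (by simp at hl' hle' ⊢; omega)
  obtain ⟨c, hc⟩ := List.prefix_of_prefix_length_le h3 h4 (by simp at hl hle ⊢; omega)
  have hXX : X ++ X = a ++ s :: (M ++ s :: c) := by simpa using hc.symm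
  have hCc : C = c ++ V := by
    rw [← hc] at h
    simpa using h
  subst hCc
  -- Here the square contains `s M s`. The cases follow the position of its centre: before `M`,
  -- inside or at an end of `M`, or after `M`.
  rcases List.append_eq_append_iff.1 hXX with ⟨b, rfl, hb⟩ | ⟨b, rfl, hb⟩
  · exact hA ⟨U ++ b, c ++ b, by rw [hb]; simp⟩
  cases b with
  | nil => exact hA ⟨U, c, by simp at hb; simp [← hb]⟩
  | cons y v =>
    simp only [List.cons_append, List.cons.injEq] at hb
    obtain ⟨rfl, hb⟩ := hb
    rcases List.append_eq_append_iff.1 hb with ⟨u, rfl, hu⟩ | ⟨u, rfl, hu⟩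
    · cases u with
      | nil =>
        simp only [List.nil_append] at hu
        refine hM M [] (by simp) ⟨U, c ++ [], ?_⟩ ⟨M ++ a, V, ?_⟩
        · simp only [List.append_nil] at hu
          simp [hu]
        · simp only [List.append_nil] at hu
          rw [← List.cons_append, hu]
          simp
      | cons y u =>
        simp only [List.cons_append, List.cons.injEq] at hu
        obtain ⟨rfl, rfl⟩ := hu
        exact hC ⟨u ++ a, u ++ V, by simp⟩
    · refine hM v u rfl ⟨U, c ++ u, ?_⟩ ⟨v ++ a, V, ?_⟩
      · have : U ++ (a ++ s :: v) ++ u = U ++ (u ++ s :: c) ++ u := by rw [hu]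
        simpa using this.symm
      · have : v ++ (a ++ s :: v) ++ V = v ++ (u ++ s :: c) ++ V := by rw [hu]
        simpa using this

/-! ### Factors of words joined by a separator. -/

/-- The words of the list, joined by the letter `s`. -/
def joinSep (s : α) : List (List α) → List α
  | [] => []
  | [B] => B
  | B :: C :: Bs => B ++ s :: joinSep s (C :: Bs)

theorem joinSep_cons (s : α) (B : List α) {Bs : List (List α)} (h : Bs ≠ []) :
    joinSep s (B :: Bs) = B ++ s :: joinSep s Bs := by
  cases Bs with
  | nil => contradiction
  | cons C Bs => rfl

theorem joinSep_append (s : α) {As Bs : List (List α)} (hA : As ≠ []) (hB : Bs ≠ []) :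
    joinSep s (As ++ Bs) = joinSep s As ++ s :: joinSep s Bs := by
  induction As with
  | nil => contradiction
  | cons A As ih =>
    cases As with
    | nil => simp [joinSep, joinSep_cons s A hB]
    | cons A' As =>
      rw [List.cons_append, joinSep_cons s A (by simp), ih (by simp), joinSep_cons s A (by simp)]
      simp

/-- A factor `s v` of a joined word starts at one of the separators. -/
theorem exists_prefix_of_infix_joinSep {s : α} {v : List α} (hv : s ∉ v) :
    ∀ {A : List α} {Bs : List (List α)}, (∀ B ∈ A :: Bs, s ∉ B) →
      s :: v <:+: joinSep s (A :: Bs) → ∃ B ∈ Bs, v <+: B := by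
  intro A Bs
  induction Bs generalizing A with
  | nil =>
    intro hs h
    exact absurd (h.subset List.mem_cons_self) (hs A (by simp))
  | cons B Bs ih =>
    rintro hs ⟨P, Q, h⟩
    have hstart : ∀ r, v ++ r = joinSep s (B :: Bs) → v <+: B := by
      intro r hr
      cases Bs with
      | nil => exact ⟨r, hr⟩
      | cons C Bs => exact prefix_of_append_eq hv hr
    rw [joinSep_cons s A (by simp), List.append_assoc] at h
    rcases List.append_eq_append_iff.1 h with ⟨c, rfl, hc⟩ | ⟨c, rfl, hc⟩
    · cases c with
      | nil => exact ⟨B, by simp, hstart Q (by simpa using hc)⟩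
      | cons y c =>
        simp only [List.cons_append, List.cons.injEq] at hc
        exact absurd (by simp [← hc.1]) (hs _ List.mem_cons_self)
    · cases c with
      | nil => exact ⟨B, by simp, hstart Q (by simpa using hc.symm)⟩
      | cons y c =>
        simp only [List.cons_append, List.cons.injEq] at hc
        obtain ⟨C, hC, hvC⟩ := ih (A := B) (fun C hC => hs C (List.mem_cons_of_mem _ hC))
          ⟨c, Q, by simp [hc.2]⟩
        exact ⟨C, List.mem_cons_of_mem _ hC, hvC⟩

/-- A factor `s M s` of a joined word is one of the inner blocks between two separators. -/
theorem mem_of_infix_joinSep {s : α} {M : List α} (hM : s ∉ M) :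
    ∀ {A : List α} {Bs : List (List α)} {R : List α}, (∀ B ∈ A :: (Bs ++ [R]), s ∉ B) →
      s :: (M ++ [s]) <:+: joinSep s (A :: (Bs ++ [R])) → M ∈ Bs := by
  intro A Bs R
  induction Bs generalizing A with
  | nil =>
    rintro hs ⟨P, Q, h⟩
    have hA := hs A (by simp)
    have hR := hs R (by simp)
    classical
    have := congrArg (List.count s) h
    simp [joinSep, List.count_eq_zero.2 hA, List.count_eq_zero.2 hR] at this
    omega
  | cons B Bs ih =>
    rintro hs ⟨P, Q, h⟩
    have hstart : M ++ s :: Q = joinSep s (B :: (Bs ++ [R])) → M = B := by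
      intro hr
      rw [joinSep_cons s B (by simp)] at hr
      exact (eq_of_append_cons_eq hM (hs B (by simp)) hr).1
    rw [List.cons_append, joinSep_cons s A (by simp), List.append_assoc] at h
    rcases List.append_eq_append_iff.1 h with ⟨c, rfl, hc⟩ | ⟨c, rfl, hc⟩
    · cases c with
      | nil => exact List.mem_cons.2 (Or.inl (hstart (by simpa using hc)))
      | cons y c =>
        simp only [List.cons_append, List.cons.injEq] at hc
        exact absurd (by simp [← hc.1]) (hs _ List.mem_cons_self)
    · cases c with
      | nil => exact List.mem_cons.2 (Or.inl (hstart (by simpa using hc.symm)))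
      | cons y c =>
        simp only [List.cons_append, List.cons.injEq] at hc
        exact List.mem_cons_of_mem _ (ih (A := B) (fun C hC => hs C (List.mem_cons_of_mem _ hC))
          ⟨c, Q, by simp [hc.2]⟩)

/-- A factor `u s` of a joined word ends at one of the separators. -/
theorem exists_suffix_of_infix_joinSep {s : α} {u : List α} (hu : s ∉ u) :
    ∀ {Bs : List (List α)} {R : List α}, (∀ B ∈ Bs ++ [R], s ∉ B) →
      u ++ [s] <:+: joinSep s (Bs ++ [R]) → ∃ B ∈ Bs, u <:+ B := by
  intro Bs R
  induction Bs with
  | nil =>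
    intro hs h
    exact absurd (h.subset (by simp)) (hs R (by simp))
  | cons B Bs ih =>
    rintro hs ⟨P, Q, h⟩
    rw [List.cons_append, joinSep_cons s B (by simp)] at h
    have h' : (P ++ u) ++ s :: Q = B ++ s :: joinSep s (Bs ++ [R]) := by simpa using h
    rcases List.append_eq_append_iff.1 h' with ⟨c, rfl, hc⟩ | ⟨c, hPu, hc⟩
    · cases c with
      | nil => exact ⟨_, List.mem_cons_self, by simp⟩
      | cons y c =>
        simp only [List.cons_append, List.cons.injEq] at hc
        exact absurd (by simp [← hc.1]) (hs _ List.mem_cons_self)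
    · cases c with
      | nil => exact ⟨_, List.mem_cons_self, P, by simpa using hPu⟩
      | cons y c =>
        simp only [List.cons_append, List.cons.injEq] at hc
        obtain ⟨rfl, hc⟩ := hc
        have huc : u <:+ c := by
          rcases List.append_eq_append_iff.1 hPu with ⟨d, -, rfl⟩ | ⟨d, -, hd⟩
          · exact absurd (by simp) hu
          · cases d with
            | nil => exact absurd (by simp [show u = s :: c by simpa using hd.symm]) hu
            | cons z d =>
              simp only [List.cons_append, List.cons.injEq] at hd
              exact ⟨d, hd.2.symm⟩
        obtain ⟨d, rfl⟩ := huc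
        obtain ⟨C, hC, huC⟩ := ih (fun C hC => hs C (List.mem_cons_of_mem _ hC))
          ⟨d, Q, by simp [hc]⟩
        exact ⟨C, List.mem_cons_of_mem _ hC, huC⟩

/-! ### Items and how their blocks identify them. -/

/-- The block lists from which the word is assembled. Joined by `s`, they give the word
`G h` itself and its insertions `p x r h` for `G = p r`, the letter `x` being put at most `K`
places from the right end; an insertion of `s` yields the two blocks `p` and `r h`. -/
inductive IsItem (s h : α) (G : List α) (K : ℕ) : List (List α) → Prop
  | whole : IsItem s h G K [G ++ [h]]
  | single (p r : List α) (x : α) (hG : G = p ++ r) (hr : r.length < K) (hp : K < p.length)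
      (hx : x ≠ s) (hpx : ∀ p', p ≠ p' ++ [x]) (hrx : ∀ q', r ++ [h] ≠ x :: q')
      (hsf : SquareFree (p ++ x :: (r ++ [h]))) : IsItem s h G K [p ++ x :: (r ++ [h])]
  | pair (p r : List α) (hG : G = p ++ r) (hr : r.length < K) (hp : K < p.length) :
      IsItem s h G K [p, r ++ [h]]

namespace IsItem

variable {s h : α} {G : List α} {K : ℕ}

theorem ne_nil {I : List (List α)} (hI : IsItem s h G K I) : I ≠ [] := by
  cases hI <;> simp

theorem sep_notMem (hsG : s ∉ G) (hsh : s ≠ h) {I : List (List α)} (hI : IsItem s h G K I) :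
    ∀ B ∈ I, s ∉ B := by
  cases hI with
  | whole => simp [hsG, hsh]
  | single p r x hG hr hp hx hpx hrx hsf => subst hG; simp_all [hx.symm]
  | pair p r hG hr hp => subst hG; simp_all

/-- No block other than `p x r h` itself starts with `p x`. -/
theorem eq_of_isPrefix {p r : List α} {x : α} (hG : G = p ++ r) (hp : K < p.length)
    (hrx : ∀ q', r ++ [h] ≠ x :: q') {I : List (List α)} (hI : IsItem s h G K I)
    {B : List α} (hB : B ∈ I) (hpB : p ++ [x] <+: B) : B = p ++ x :: (r ++ [h]) := by
  obtain ⟨c, rfl⟩ := hpB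
  cases hI with
  | whole =>
    subst hG
    simp only [List.mem_singleton, List.append_assoc, List.append_cancel_left_eq] at hB
    exact absurd hB.symm (hrx _)
  | single p' r' y hG' hr' hp' hy hpy hry hsf =>
    simp only [List.mem_singleton] at hB
    rw [hG] at hG'
    rcases List.append_eq_append_iff.1 hG' with ⟨a, rfl, rfl⟩ | ⟨a, rfl, rfl⟩
    · cases a with
      | nil => simp_all
      | cons z a => simp_all
    · cases a with
      | nil => simp_all
      | cons z a => simp_all
  | pair p' r' hG' hr' hp' =>
    simp only [List.mem_cons, List.not_mem_nil, or_false] at hB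
    rcases hB with hB | hB
    · subst hB
      rw [hG] at hG'
      simp only [List.append_assoc, List.append_cancel_left_eq] at hG'
      exact absurd (by rw [hG']; rfl) (hrx (c ++ r' ++ [h]))
    · have := congrArg List.length hB
      simp at this
      omega

/-- No block other than `p x r h` itself ends with `x r h`. -/
theorem eq_of_isSuffix (hhG : h ∉ G) {p r : List α} {x : α} (hG : G = p ++ r)
    (hpx : ∀ p', p ≠ p' ++ [x]) {I : List (List α)} (hI : IsItem s h G K I)
    {B : List α} (hB : B ∈ I) (hrB : x :: (r ++ [h]) <:+ B) : B = p ++ x :: (r ++ [h]) := by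
  obtain ⟨c, rfl⟩ := hrB
  have aux : ∀ d r' : List α, r' = c ++ x :: r → p ++ r = d ++ r' → False := by
    rintro d r' rfl he
    refine hpx (d ++ c) ?_
    have he : p ++ r = (d ++ c ++ [x]) ++ r := by simpa using he
    exact List.append_cancel_right he
  cases hI with
  | whole =>
    simp only [List.mem_singleton] at hB
    have hB' : G ++ [h] = (c ++ x :: r) ++ [h] := by rw [← hB]; simp
    exact (aux [] G (List.append_cancel_right hB') (by simp [hG])).elim
  | single p' r' y hG' hr' hp' hy hpy hry hsf =>
    simp only [List.mem_singleton] at hB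
    have hB' : (c ++ x :: r) ++ [h] = (p' ++ y :: r') ++ [h] := by simpa using hB
    replace hB' := List.append_cancel_right hB'
    rw [hG] at hG'
    -- If the two insertions were at different places, the later one would put a letter next to an
    -- equal letter on its left, against `hpx` or `hpy`.
    have hc : c = p := by
      rcases List.append_eq_append_iff.1 hG' with ⟨a, rfl, rfl⟩ | ⟨a, rfl, rfl⟩
      · have h1 : (c ++ [x]) ++ (a ++ r') = (p ++ a ++ [y]) ++ r' := by simpa using hB'
        have h2 : (c ++ [x]) ++ a = (p ++ a) ++ [y] := by
          rw [← List.append_assoc] at h1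
          exact List.append_cancel_right h1
        rcases List.eq_nil_or_concat a with rfl | ⟨b, z, rfl⟩
        · exact (List.append_inj' (by simpa using h2 : c ++ [x] = p ++ [y]) rfl).1
        · have h3 : ((c ++ [x]) ++ b) ++ [z] = (p ++ (b ++ [z])) ++ [y] := by
            simpa using h2
          have h4 := (List.append_inj' h3 rfl).2
          simp only [List.cons.injEq, and_true] at h4
          exact absurd (by rw [h4]; simp) (hpy (p ++ b))
      · have h1 : (c ++ [x]) ++ r = (p' ++ [y] ++ a) ++ r := by simpa using hB'
        have h2 := List.append_cancel_right h1
        rcases List.eq_nil_or_concat a with rfl | ⟨b, z, rfl⟩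
        · simpa using (List.append_inj' (by simpa using h2 : c ++ [x] = p' ++ [y]) rfl).1
        · have h3 : c ++ [x] = (p' ++ [y] ++ b) ++ [z] := by simpa using h2
          have h4 := (List.append_inj' h3 rfl).2
          simp only [List.cons.injEq, and_true] at h4
          exact absurd (by rw [h4]; simp) (hpx (p' ++ b))
    rw [hc]
  | pair p' r' hG' hr' hp' =>
    simp only [List.mem_cons, List.not_mem_nil, or_false] at hB
    rcases hB with hB | hB
    · exact absurd (by rw [hG', ← hB]; simp) hhG
    · have hB' : r' ++ [h] = (c ++ x :: r) ++ [h] := by rw [← hB]; simp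
      exact (aux p' r' (List.append_cancel_right hB') (by rw [← hG, hG'])).elim

/-- Lengths separate the kinds of blocks: `|G| + 1` for the whole block, `|G| + 2` for an insertion,
more than `K` and at most `|G|` for `p`, at most `K` for `r h`. -/
theorem eq_of_mem {I J : List (List α)} (hI : IsItem s h G K I)
    (hJ : IsItem s h G K J) {B : List α} (hBI : B ∈ I) (hBJ : B ∈ J) : I = J := by
  cases hI with
  | whole =>
    cases hJ with
    | whole => rfl
    | single p' r' y hG' hr' hp' hy hpy hry hsf' =>
      have h1 := congrArg List.length hG'
      simp only [List.mem_singleton] at hBI hBJ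
      have h2 := congrArg List.length (hBI.symm.trans hBJ)
      simp at h1 h2
      omega
    | pair p' r' hG' hr' hp' =>
      have h1 := congrArg List.length hG'
      simp only [List.mem_cons, List.not_mem_nil, or_false] at hBI hBJ
      rcases hBJ with hBJ | hBJ <;> have h2 := congrArg List.length (hBI.symm.trans hBJ) <;>
        simp at h1 h2 <;> omega
  | single p r x hG hr hp hx hpx hrx hsf =>
    simp only [List.mem_singleton] at hBI
    subst hBI
    have h1 := congrArg List.length hG
    cases hJ with
    | whole =>
      simp only [List.mem_singleton] at hBJ
      have h2 := congrArg List.length hBJ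
      simp at h1 h2
      omega
    | single p' r' y hG' hr' hp' hy hpy hry hsf' =>
      simp only [List.mem_singleton] at hBJ
      rw [hBJ]
    | pair p' r' hG' hr' hp' =>
      have h3 := congrArg List.length hG'
      simp only [List.mem_cons, List.not_mem_nil, or_false] at hBJ
      rcases hBJ with hBJ | hBJ <;> have h2 := congrArg List.length hBJ <;>
        simp at h1 h2 h3 <;> omega
  | pair p r hG hr hp =>
    have h1 := congrArg List.length hG
    simp only [List.mem_cons, List.not_mem_nil, or_false] at hBI
    cases hJ with
    | whole =>
      simp only [List.mem_singleton] at hBJ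
      rcases hBI with hBI | hBI <;> have h2 := congrArg List.length (hBI.symm.trans hBJ) <;>
        simp at h1 h2 <;> omega
    | single p' r' y hG' hr' hp' hy hpy hry hsf' =>
      have h3 := congrArg List.length hG'
      simp only [List.mem_singleton] at hBJ
      rcases hBI with hBI | hBI <;> have h2 := congrArg List.length (hBI.symm.trans hBJ) <;>
        simp at h1 h2 h3 <;> omega
    | pair p' r' hG' hr' hp' =>
      simp only [List.mem_cons, List.not_mem_nil, or_false] at hBJ
      have hlen := (congrArg List.length : p ++ r = p' ++ r' → _) (hG.symm.trans hG')
      rcases hBI with hBI | hBI <;> rcases hBJ with hBJ | hBJ <;>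
        have h2 := congrArg List.length (hBI.symm.trans hBJ) <;> simp at h1 h2 hlen
      · obtain ⟨rfl, rfl⟩ := List.append_inj (hG.symm.trans hG') h2
        rfl
      · omega
      · omega
      · obtain ⟨rfl, rfl⟩ := List.append_inj (hG.symm.trans hG') (by omega)
        rfl

end IsItem

/-! ### Joining items without creating squares. -/

theorem mem_of_infix_joinSep_cons {s : α} {M : List α} (hM : s ∉ M) {A : List α}
    {Bs : List (List α)} (hs : ∀ B ∈ A :: Bs, s ∉ B)
    (h : s :: (M ++ [s]) <:+: joinSep s (A :: Bs)) : M ∈ Bs := by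
  rcases List.eq_nil_or_concat Bs with rfl | ⟨Cs, R, rfl⟩
  · exact absurd (h.subset List.mem_cons_self) (hs A (by simp))
  · rw [List.concat_eq_append] at h hs ⊢
    exact List.mem_append_left _ (mem_of_infix_joinSep hM hs h)

theorem mem_of_infix_joinSep_concat {s : α} {M : List α} (hM : s ∉ M) {R : List α}
    {Bs : List (List α)} (hs : ∀ B ∈ Bs ++ [R], s ∉ B)
    (h : s :: (M ++ [s]) <:+: joinSep s (Bs ++ [R])) : M ∈ Bs := by
  cases Bs with
  | nil => exact absurd (h.subset List.mem_cons_self) (hs R (by simp))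
  | cons A Bs => exact List.mem_cons_of_mem _ (mem_of_infix_joinSep hM hs h)

theorem squareFree_three_blocks {s : α} {A M C : List α} (hA : SquareFree A) (hM : SquareFree M)
    (hC : SquareFree C) (hsA : s ∉ A) (hsM : s ∉ M) (hsC : s ∉ C)
    (h : ∀ v u, M = v ++ u → u <:+ A → v <+: C → False) :
    SquareFree (A ++ s :: (M ++ s :: C)) := by
  refine SquareFree.append_sep_append_sep (hA.append_sep hM hsA hsM) (hM.append_sep hC hsM hsC)
    (fun hi => hsA (hi.subset List.mem_cons_self)) (fun hi => hsC (hi.subset List.mem_cons_self)) ?_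
  intro v u hvu hu hv
  subst hvu
  simp only [List.mem_append, not_or] at hsM
  obtain ⟨B, hB, huB⟩ := exists_suffix_of_infix_joinSep (Bs := [A]) hsM.2 (by simp_all) hu
  obtain ⟨B', hB', hvB⟩ := exists_prefix_of_infix_joinSep (Bs := [C]) hsM.1 (by simp_all) hv
  simp only [List.mem_singleton] at hB hB'
  subst hB hB'
  exact h v u rfl huB hvB

namespace IsItem

variable {s h : α} {G : List α} {K : ℕ}

theorem squareFree_of_mem (hG : SquareFree G) (hhG : h ∉ G) {I : List (List α)}
    (hI : IsItem s h G K I) : ∀ B ∈ I, SquareFree B := by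
  have hE : SquareFree (G ++ [h]) :=
    hG.append_sep (B := []) (fun U X V h => by simp_all) hhG (by simp)
  cases hI with
  | whole => simpa using hE
  | single p r x hG hr hp hx hpx hrx hsf => simpa using hsf
  | pair p r hG' hr hp =>
    subst hG'
    simp only [List.mem_cons, List.not_mem_nil, or_false, forall_eq_or_imp, forall_eq]
    exact ⟨hG.of_factor ⟨[], r, by simp⟩, hE.of_factor ⟨p, [], by simp⟩⟩

theorem shape (hhG : h ∉ G) (hK : K < G.length) {I : List (List α)} (hI : IsItem s h G K I) :
    (∃ c d, I = [c ++ (d ++ [h])] ∧ h ∉ c ∧ K < c.length) ∨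
      ∃ p r, I = [p, r ++ [h]] ∧ G = p ++ r ∧ r.length < K ∧ K < p.length := by
  cases hI with
  | whole => exact Or.inl ⟨G, [], by simp, hhG, hK⟩
  | single p r x hG hr hp hx hpx hrx hsf =>
    exact Or.inl ⟨p, x :: r, by simp, fun hh => hhG (by simp [hG, hh]), hp⟩
  | pair p r hG' hr hp => exact Or.inr ⟨p, r, rfl, hG', hr, hp⟩

/-- Base case of the Zimin induction. The letter `h`, absent from `G`, marks the end of `r h`: a
split `v u` of a middle block is defeated by `h` or by length, except when two pairs have equal
second blocks, and then the pairs coincide. -/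
theorem squareFree_joinSep_append (hG : SquareFree G) (hsG : s ∉ G) (hhG : h ∉ G) (hsh : s ≠ h)
    (hK : K < G.length) {L R : List (List α)} (hL : IsItem s h G K L) (hR : IsItem s h G K R)
    (hLR : L ≠ R) : SquareFree (joinSep s (L ++ R)) := by
  have hLs := hL.sep_notMem hsG hsh
  have hRs := hR.sep_notMem hsG hsh
  have hLq := hL.squareFree_of_mem hG hhG
  have hRq := hR.squareFree_of_mem hG hhG
  -- a block ending with `h`, followed by a pair
  have before_pair : ∀ (c p r : List α), SquareFree (c ++ [h]) → s ∉ c ++ [h] → G = p ++ r →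
      r.length < K → K < p.length → SquareFree p → SquareFree (r ++ [h]) → s ∉ p →
      s ∉ r ++ [h] → SquareFree ((c ++ [h]) ++ s :: (p ++ s :: (r ++ [h]))) := by
    intro c p r hc hsc hGp hr hp hpq hrq hsp hsr
    refine squareFree_three_blocks hc hpq hrq hsc hsp hsr ?_
    rintro v u rfl hu hv
    have hlen := hv.length_le
    rcases List.eq_nil_or_concat u with rfl | ⟨b, z, rfl⟩
    · simp at hlen hp
      omega
    · obtain ⟨d, hd⟩ := hu
      have h1 : (d ++ b) ++ [z] = c ++ [h] := by simpa using hd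
      have h2 := (List.append_inj' h1 rfl).2
      simp only [List.cons.injEq, and_true] at h2
      exact hhG (by simp [hGp, h2])
  -- the second block of a pair and the blocks around it
  have centre : ∀ (p r v u B : List α), G = p ++ r → r ++ [h] = v ++ u → u <:+ p → v <+: B →
      r ++ [h] <+: B := by
    intro p r v u B hGp hvu hu hv
    rcases List.eq_nil_or_concat u with rfl | ⟨b, z, rfl⟩
    · simp only [List.append_nil] at hvu
      rwa [hvu]
    · have h1 : r ++ [h] = (v ++ b) ++ [z] := by simpa using hvu
      have h2 := (List.append_inj' h1 rfl).2
      simp only [List.cons.injEq, and_true] at h2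
      have : z ∈ p := hu.subset (by simp)
      exact absurd (by rw [h2, hGp]; simp [this]) hhG
  rcases hL.shape hhG hK with ⟨c, d, rfl, hhc, hcK⟩ | ⟨p, r, rfl, hGp, hr, hp⟩ <;>
  rcases hR.shape hhG hK with ⟨c', d', rfl, hhc', hcK'⟩ | ⟨p', r', rfl, hGp', hr', hp'⟩
  · exact (hLq _ (by simp)).append_sep (hRq _ List.mem_cons_self) (hLs _ (by simp))
      (hRs _ List.mem_cons_self)
  · have := before_pair (c ++ d) p' r' (by simpa using hLq) (by simpa using hLs) hGp' hr' hp'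
      (hRq _ (by simp)) (hRq _ (by simp)) (hRs _ (by simp)) (hRs _ (by simp))
    simpa [joinSep] using this
  · refine squareFree_three_blocks (hLq _ (by simp)) (hLq _ (by simp)) (hRq _ List.mem_cons_self)
      (hLs _ (by simp)) (hLs _ (by simp)) (hRs _ List.mem_cons_self) ?_
    intro v u hvu hu hv
    have h1 := centre p r v u _ hGp hvu hu hv
    have h2 := List.prefix_of_prefix_length_le h1 (List.prefix_append c' _) (by simp; omega)
    exact hhc' (h2.subset (by simp))
  · have hpair := before_pair r p' r' (hLq _ (by simp)) (hLs _ (by simp)) hGp' hr' hp'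
      (hRq _ (by simp)) (hRq _ (by simp)) (hRs _ (by simp)) (hRs _ (by simp))
    have hsr : s ∉ r ++ [h] := hLs _ (by simp)
    have hsblocks : ∀ B ∈ [r ++ [h], p', r' ++ [h]], s ∉ B := by
      intro B hB
      rcases List.mem_cons.1 hB with rfl | hB
      · exact hsr
      · exact hRs B hB
    refine SquareFree.append_sep_append_sep (A := p) (M := r ++ [h]) (C := p' ++ s :: (r' ++ [h]))
      ((hLq _ (by simp)).append_sep (hLq _ (by simp)) (hLs _ (by simp)) hsr) hpair
      (fun hi => hLs p (by simp) (hi.subset List.mem_cons_self)) ?_ ?_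
    · intro hi
      simpa using mem_of_infix_joinSep (Bs := []) hsr hRs hi
    · intro v u hvu hu hv
      have hs' : s ∉ v ∧ s ∉ u := by
        rw [hvu] at hsr
        simpa using hsr
      obtain ⟨B, hB, huB⟩ := exists_suffix_of_infix_joinSep (Bs := [p]) hs'.2 hLs hu
      obtain ⟨B', hB', hvB⟩ := exists_prefix_of_infix_joinSep
        (Bs := [p', r' ++ [h]]) hs'.1 hsblocks hv
      simp only [List.mem_singleton] at hB
      subst hB
      have h1 := centre B r v u _ hGp hvu huB hvB
      simp only [List.mem_cons, List.not_mem_nil, or_false] at hB'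
      rcases hB' with rfl | rfl
      · exact hhG (by rw [hGp']; exact List.mem_append_left _ (h1.subset (by simp)))
      · obtain ⟨d, hd⟩ := h1
        rcases List.eq_nil_or_concat d with rfl | ⟨b, z, rfl⟩
        · have h2 : r = r' := by simpa using hd
          subst h2
          have h3 : B = p' := List.append_cancel_right (hGp.symm.trans hGp')
          subst h3
          exact hLR rfl
        · have h2 : (r ++ h :: b) ++ [z] = r' ++ [h] := by simpa using hd
          have h3 := (List.append_inj' h2 rfl).1
          exact hhG (by rw [hGp', ← h3]; simp)

/-- If neither `X` nor `Y` contains a block of the item `M`, squares in the word joined from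
`X`, `M` and `Y` already occur to the left or to the right of one of its ends. -/
theorem squareFree_joinSep_insert (hsG : s ∉ G) (hhG : h ∉ G) (hsh : s ≠ h)
    {X M Y : List (List α)} (hM : IsItem s h G K M) (hME : M ≠ [G ++ [h]]) (hX : X ≠ [])
    (hY : Y ≠ []) (hXM : ∀ B ∈ X, ∃ I, IsItem s h G K I ∧ I ≠ M ∧ B ∈ I)
    (hYM : ∀ B ∈ Y, ∃ I, IsItem s h G K I ∧ I ≠ M ∧ B ∈ I)
    (h1 : SquareFree (joinSep s (X ++ M))) (h2 : SquareFree (joinSep s (M ++ Y))) :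
    SquareFree (joinSep s (X ++ (M ++ Y))) := by
  have hMs := hM.sep_notMem hsG hsh
  have hXs : ∀ B ∈ X, s ∉ B := fun B hB =>
    let ⟨_, hI, _, hBI⟩ := hXM B hB; hI.sep_notMem hsG hsh B hBI
  have hYs : ∀ B ∈ Y, s ∉ B := fun B hB =>
    let ⟨_, hI, _, hBI⟩ := hYM B hB; hI.sep_notMem hsG hsh B hBI
  have hXn : ∀ B ∈ M, B ∉ X := fun B hB hBX =>
    let ⟨_, hI, hne, hBI⟩ := hXM B hBX; hne (hI.eq_of_mem hM hBI hB)
  have hYn : ∀ B ∈ M, B ∉ Y := fun B hB hBY =>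
    let ⟨_, hI, hne, hBI⟩ := hYM B hBY; hne (hI.eq_of_mem hM hBI hB)
  have hXi : ∀ B ∈ M, ¬ s :: (B ++ [s]) <:+: joinSep s X := by
    intro B hB hi
    obtain ⟨A, X, rfl⟩ := List.exists_cons_of_ne_nil hX
    exact hXn B hB (List.mem_cons_of_mem _ (mem_of_infix_joinSep_cons (hMs B hB) hXs hi))
  have hYi : ∀ B ∈ M, ¬ s :: (B ++ [s]) <:+: joinSep s Y := by
    intro B hB hi
    obtain ⟨A, Y, rfl⟩ := List.exists_cons_of_ne_nil hY
    exact hYn B hB (List.mem_cons_of_mem _ (mem_of_infix_joinSep_cons (hMs B hB) hYs hi))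
  have hXMs : ∀ B ∈ X ++ M, s ∉ B := fun B hB => (List.mem_append.1 hB).elim (hXs B) (hMs B)
  have hMYs : ∀ B ∈ M ++ Y, s ∉ B := fun B hB => (List.mem_append.1 hB).elim (hMs B) (hYs B)
  have hMn := hM.ne_nil
  rw [joinSep_append s hX (by simp [hMn]), joinSep_append s hMn hY]
  have h1' := h1
  have h2' := h2
  rw [joinSep_append s hX hMn] at h1'
  rw [joinSep_append s hMn hY] at h2'
  cases hM with
  | whole => exact absurd rfl hME
  | single p r x hG hr hp hx hpx hrx hsf =>
    refine SquareFree.append_sep_append_sep h1' h2' (hXi _ List.mem_cons_self)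
      (hYi _ List.mem_cons_self) ?_
    intro v u hvu hu hv
    rw [← joinSep_append s hX hMn] at hu
    rw [← joinSep_append s hMn hY] at hv
    simp only [joinSep] at hvu
    have hs' : s ∉ v ∧ s ∉ u := by
      have := hMs _ List.mem_cons_self
      rw [hvu] at this
      simpa using this
    obtain ⟨B, hB, huB⟩ := exists_suffix_of_infix_joinSep hs'.2 hXMs hu
    obtain ⟨B', hB', hvB⟩ := exists_prefix_of_infix_joinSep hs'.1 hMYs hv
    -- A longer `v` would contain `p x` and a longer `u` would contain `x r h`, either of which
    -- identifies the item. So `v u` is too short by at least one letter, the inserted one.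
    have hvle : v.length ≤ p.length := by
      by_contra hlt
      obtain ⟨I, hI, hne, hBI⟩ := hYM B' hB'
      have hpv : p ++ [x] <+: v := List.prefix_of_prefix_length_le
        (l₃ := p ++ x :: (r ++ [h])) ⟨r ++ [h], by simp⟩ ⟨u, hvu.symm⟩ (by simp; omega)
      have := eq_of_isPrefix hG hp hrx hI hBI (hpv.trans hvB)
      exact hYn B' (by simp [this]) hB'
    have hule : u.length ≤ (r ++ [h]).length := by
      by_contra hlt
      obtain ⟨I, hI, hne, hBI⟩ := hXM B hB
      have hru : x :: (r ++ [h]) <:+ u := List.suffix_of_suffix_length_le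
        (l₃ := p ++ x :: (r ++ [h])) ⟨p, by simp⟩ ⟨v, hvu.symm⟩ (by simp at hlt ⊢; omega)
      have := eq_of_isSuffix hhG hG hpx hI hBI (hru.trans huB)
      exact hXn B (by simp [this]) hB
    have := congrArg List.length hvu
    simp at this hule
    omega
  | pair p r hG hr hp =>
    have hpr : p ≠ r ++ [h] := by
      intro he
      have := congrArg List.length he
      simp at this
      omega
    refine SquareFree.append_sep_append_sep h1' h2'
      (fun hi => hXi p (by simp) (List.IsInfix.trans ⟨[], (r ++ [h]) ++ [s], by simp [joinSep]⟩ hi))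
      (fun hi => hYi p (by simp) (List.IsInfix.trans ⟨[], (r ++ [h]) ++ [s], by simp [joinSep]⟩ hi))
      ?_
    intro v u hvu hu hv
    rw [← joinSep_append s hX hMn] at hu
    rw [← joinSep_append s hMn hY] at hv
    have hq : ¬ s :: ((r ++ [h]) ++ [s]) <:+: joinSep s (X ++ [p, r ++ [h]]) := by
      intro hi
      have hsplit : X ++ [p, r ++ [h]] = (X ++ [p]) ++ [r ++ [h]] := by simp
      rw [hsplit] at hi hXMs
      have := mem_of_infix_joinSep_concat (hMs _ (by simp)) hXMs hi
      rcases List.mem_append.1 this with hm | hm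
      · exact hXn _ (by simp) hm
      · exact hpr (List.mem_singleton.1 hm).symm
    have hpn : ¬ s :: (p ++ [s]) <:+: joinSep s ([p, r ++ [h]] ++ Y) := by
      intro hi
      have := mem_of_infix_joinSep_cons (hMs p (by simp)) hMYs hi
      rcases List.mem_append.1 this with hm | hm
      · exact hpr (List.mem_singleton.1 hm)
      · exact hYn _ (by simp) hm
    simp only [joinSep] at hvu
    -- Whichever way `p s r h` is cut, `s v` contains `s p s` or `u s` contains `s r h s`.
    rcases List.append_eq_append_iff.1 hvu with ⟨a, rfl, ha⟩ | ⟨a, rfl, rfl⟩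
    · cases a with
      | nil =>
        refine hq (List.IsInfix.trans ⟨[], [], ?_⟩ hu)
        simp only [List.nil_append] at ha
        simp [← ha]
      | cons y a =>
        simp only [List.cons_append, List.cons.injEq] at ha
        obtain ⟨rfl, -⟩ := ha
        exact hpn (List.IsInfix.trans ⟨[], a, by simp⟩ hv)
    · exact hq (List.IsInfix.trans ⟨a, [], by simp⟩ hu)

end IsItem

/-! ### Zimin words on items. -/

/-- The Zimin word on a list of words: each of them is placed between two copies of the Zimin word
on the rest of the list. -/
def zimin {β : Type*} : List (List β) → List β
  | [] => []
  | I :: Is => zimin Is ++ (I ++ zimin Is)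

theorem exists_mem_of_mem_zimin {β : Type*} {Ms : List (List β)} {B : β} (hB : B ∈ zimin Ms) :
    ∃ I ∈ Ms, B ∈ I := by
  induction Ms with
  | nil => simp [zimin] at hB
  | cons I Is ih =>
    simp only [zimin, List.mem_append] at hB
    simp only [List.mem_cons, exists_eq_or_imp]
    tauto

theorem exists_suffix_zimin {β : Type*} {Ms : List (List β)} {M : List β} (hM : M ∈ Ms) :
    ∃ Z Y, zimin Ms = Y ++ (Z ++ M ++ Z) := by
  induction Ms with
  | nil => simp at hM
  | cons I Is ih =>
    rcases List.mem_cons.1 hM with rfl | hM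
    · exact ⟨zimin Is, [], by simp [zimin]⟩
    · obtain ⟨Z, Y, h⟩ := ih hM
      exact ⟨Z, zimin Is ++ (I ++ Y), by simp [zimin, h]⟩

theorem squareFree_joinSep_zimin {s h : α} {G : List α} {K : ℕ} (hG : SquareFree G) (hsG : s ∉ G)
    (hhG : h ∉ G) (hsh : s ≠ h) (hK : K < G.length) {Ms : List (List (List α))} (hnd : Ms.Nodup)
    (hMs : ∀ M ∈ Ms, IsItem s h G K M ∧ M ≠ [G ++ [h]]) {L R : List (List α)}
    (hL : IsItem s h G K L) (hR : IsItem s h G K R) (hLM : L ∉ Ms) (hRM : R ∉ Ms) (hLR : L ≠ R) :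
    SquareFree (joinSep s (L ++ (zimin Ms ++ R))) := by
  induction Ms generalizing L R with
  | nil => exact hL.squareFree_joinSep_append hG hsG hhG hsh hK hR hLR
  | cons M Ms ih =>
    simp only [List.mem_cons, not_or, List.nodup_cons, forall_eq_or_imp] at *
    obtain ⟨⟨hM, hME⟩, hMs⟩ := hMs
    have hZ : ∀ B ∈ zimin Ms, ∃ I, IsItem s h G K I ∧ I ≠ M ∧ B ∈ I := by
      intro B hB
      obtain ⟨I, hI, hBI⟩ := exists_mem_of_mem_zimin hB
      exact ⟨I, (hMs I hI).1, fun he => hnd.1 (he ▸ hI), hBI⟩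
    -- `M` serves once as the right end and once as the left end, which is why the ends are
    -- generalized in the induction.
    have h1 := ih hnd.2 hMs hL hM hLM.2 hnd.1 hLM.1
    have h2 := ih hnd.2 hMs hM hR hnd.1 hRM.2 (Ne.symm hRM.1)
    have := hM.squareFree_joinSep_insert (X := L ++ zimin Ms) (Y := zimin Ms ++ R) hsG hhG hsh hME
      (by simp [hL.ne_nil]) (by simp [hR.ne_nil]) ?_ ?_ (by simpa using h1) h2
    · simpa [zimin] using this
    · intro B hB
      rcases List.mem_append.1 hB with hB | hB
      · exact ⟨L, hL, hLM.1, hB⟩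
      · exact hZ B hB
    · intro B hB
      rcases List.mem_append.1 hB with hB | hB
      · exact hZ B hB
      · exact ⟨R, hR, hRM.1, hB⟩

/-- The nonempty `L` supplies the separator in front of the first `Z M`, completing the square of `s
Z M`. -/
theorem not_squareFree_joinSep_zimin (s : α) {L M : List (List α)} {Ms : List (List (List α))}
    (hL : L ≠ []) (hM : M ∈ Ms) (hM0 : M ≠ []) :
    ¬ SquareFree (joinSep s (L ++ (zimin Ms ++ M))) := by
  intro hsf
  obtain ⟨Z, Y, hZ⟩ := exists_suffix_zimin hM
  have hsplit : L ++ (zimin Ms ++ M) = (L ++ Y) ++ ((Z ++ M) ++ (Z ++ M)) := by simp [hZ]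
  have hZM : Z ++ M ≠ [] := by simp [hM0]
  rw [hsplit, joinSep_append s (As := L ++ Y) (by simp [hL]) (by simp [hM0]),
    joinSep_append s hZM hZM] at hsf
  have := hsf (joinSep s (L ++ Y)) (s :: joinSep s (Z ++ M)) [] (by simp)
  simp at this

theorem finite_isItem [Finite α] (s h : α) (G : List α) (K : ℕ) :
    {I | IsItem s h G K I}.Finite := by
  let f : Option (Fin (G.length + 1) × Option α) → List (List α)
    | none => [G ++ [h]]
    | some (i, none) => [G.take i, G.drop i ++ [h]]
    | some (i, some x) => [G.take i ++ x :: (G.drop i ++ [h])]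
  refine (Set.finite_range f).subset ?_
  intro I hI
  cases hI with
  | whole => exact ⟨none, rfl⟩
  | single p r x hG hr hp hx hpx hrx hsf =>
    subst hG
    exact ⟨some (⟨p.length, by simp⟩, some x), by simp [f]⟩
  | pair p r hG hr hp =>
    subst hG
    exact ⟨some (⟨p.length, by simp⟩, none), by simp [f]⟩

/-! ### Assembling the word. -/

theorem exists_squareFree_not_extendableAt (t : ℕ) :
    ∃ W : List (Fin 5), SquareFree W ∧ t < W.length ∧
      ∀ k : ℕ, 1 ≤ k → k ≤ t → ¬ ExtendableAt W k := by
  -- This length lets every cut with `|r| ≤ t` satisfy `|r| < t + 1 < |p|`, as items with `K = t +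
  -- 1` require.
  obtain ⟨G, hGlen, hG, hG3⟩ := exists_squareFree_ternary (2 * t + 3)
  have hsG : (4 : Fin 5) ∉ G := fun hm => absurd (hG3 _ hm) (by decide)
  have hhG : (3 : Fin 5) ∉ G := fun hm => absurd (hG3 _ hm) (by decide)
  have hsplit : ∀ k ≤ t, ∃ p r : List (Fin 5), G = p ++ r ∧ r.length = k ∧ t + 1 < p.length :=
    fun k hk => ⟨G.take (2 * t + 3 - k), G.drop (2 * t + 3 - k), by simp,
      by simp [hGlen]; omega, by simp [hGlen]; omega⟩
  -- The cut with `|r₀| = t` is free to serve as left end: insertions at `k ≤ t` only use `|r| = k -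
  -- 1 < t`, the final `h` accounting for the shift.
  obtain ⟨p₀, r₀, hG₀, hr₀, hp₀⟩ := hsplit t le_rfl
  have hL : IsItem 4 3 G (t + 1) [p₀, r₀ ++ [3]] := .pair p₀ r₀ hG₀ (by omega) hp₀
  have hfin : {I | IsItem 4 3 G (t + 1) I ∧ I ≠ [G ++ [3]] ∧ I ≠ [p₀, r₀ ++ [3]]}.Finite :=
    (finite_isItem 4 3 G (t + 1)).subset fun I hI => hI.1
  obtain ⟨Ms, hnd, hMs⟩ : ∃ Ms : List (List (List (Fin 5))), Ms.Nodup ∧ ∀ I, I ∈ Ms ↔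
      IsItem 4 3 G (t + 1) I ∧ I ≠ [G ++ [3]] ∧ I ≠ [p₀, r₀ ++ [3]] :=
    ⟨hfin.toFinset.toList, hfin.toFinset.nodup_toList, fun I => by simp⟩
  set L : List (List (Fin 5)) := [p₀, r₀ ++ [3]] with hLdef
  set P := joinSep 4 (L ++ zimin Ms) with hP
  have hjoin : ∀ M, M ≠ [] → joinSep 4 (L ++ (zimin Ms ++ M)) = P ++ 4 :: joinSep 4 M := by
    intro M hM
    rw [← List.append_assoc, joinSep_append 4 (by simp [hLdef]) hM]
  refine ⟨joinSep 4 (L ++ (zimin Ms ++ [G ++ [3]])), ?_, ?_, ?_⟩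
  · refine squareFree_joinSep_zimin hG hsG hhG (by decide) (by omega) hnd
      (fun M hM => ⟨((hMs M).1 hM).1, ((hMs M).1 hM).2.1⟩) hL .whole ?_ ?_ (by simp [hLdef])
    · simp [hMs]
    · simp [hMs]
  · rw [hjoin _ (by simp)]
    simp [joinSep, hGlen]
    omega
  · rintro k hk hkt ⟨W', W'', x, hW, hlen, hsf⟩
    obtain ⟨p, r, hGp, hr, hp⟩ := hsplit (k - 1) (by omega)
    have hW2 : W' ++ W'' = (P ++ 4 :: p) ++ (r ++ [3]) := by
      rw [← hW, hjoin _ (by simp), hGp]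
      simp [joinSep]
    obtain ⟨rfl, rfl⟩ := List.append_inj' hW2 (by simp; omega)
    have hne : ∀ M, M ∈ Ms → joinSep 4 M ≠ p ++ x :: (r ++ [3]) := by
      intro M hM he
      have hM0 := ((hMs M).1 hM).1.ne_nil
      refine not_squareFree_joinSep_zimin 4 (L := L) (by simp [hLdef]) hM hM0 ?_
      rw [hjoin M hM0, he]
      simpa using hsf
    by_cases hx : x = 4
    · subst hx
      refine hne [p, r ++ [3]] ((hMs _).2 ⟨.pair p r hGp (by omega) hp, by simp, ?_⟩) rfl
      intro he
      have : r = r₀ := by simpa [hLdef] using (List.cons.inj he).2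
      rw [this] at hr
      omega
    -- The item's conditions on `x` hold because the extended word is assumed square-free.
    · refine hne [p ++ x :: (r ++ [3])] ((hMs _).2 ⟨.single p r x hGp (by omega) hp hx ?_ ?_ ?_,
        ?_, by simp [hLdef]⟩) rfl
      · rintro p' rfl
        simpa using hsf (P ++ 4 :: p') [x] (r ++ [3]) (by simp)
      · intro q' hq'
        rw [hq'] at hsf
        simpa using hsf (P ++ 4 :: p) [x] q' (by simp)
      · exact hsf.of_factor ⟨P ++ [4], [], by simp⟩
      · intro he
        have := congrArg List.length (List.cons.inj he).1
        simp [hGp] at this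

end SquareFreeWords

/-- The condition `t < W.length` says that `W` has at least `t` inner positions; the `t` rightmost
ones are then those with index `k = 1, …, t`. -/
theorem proposition2p3 (t : ℕ) (ht : 87 ≤ t) :
    ∃ W : List (Fin 5), SquareFreeWords.SquareFree W ∧ t < W.length ∧
      ∀ k : ℕ, 1 ≤ k → k ≤ t → ¬ SquareFreeWords.ExtendableAt W k := by
  exact SquareFreeWords.exists_squareFree_not_extendableAt t
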